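/- Let $L^2$ be the Lebesgue space on the unit circle $\mathbb{T}$ and let $H^2\subset L^2$ be the Hardy space, i.e. the functions whose Fourier coefficients of negative index vanish. Let $\mathbb{P}:L^2\to H^2$ be the Riesz projection, that is, the orthogonal projection of $L^2$ onto $H^2$. Let $\mathrm{Rat}(\mathbb{T})$ be the space of rational complex functions whose poles in $\mathbb{C}$ all lie on $\mathbb{T}$. Let $\mathrm{Rat}_0(\mathbb{T})$ be the subspace of strictly proper functions in $\mathrm{Rat}(\mathbb{T})$. For $\omega\in\mathrm{Rat}(\mathbb{T})$ let $T_\omega$ be the (in general unbounded) Toeplitz-like operator on $H^2$ given by $$\mathrm{Dom}(T_\omega)=\{g\in H^2 : \omega g=f+\rho \text{ for some } f\in L^2,\ \rho\in\mathrm{Rat}_0(\mathbb{T})\},\qquad T_\omega g=\mathbb{P}f .$$ Let $H(\overline{\mathbb{D}})$ be the space of functions analytic on a neighbourhood of the closed unit disc $\overline{\mathbb{D}}$, regarded as a subspace of $H^2$ through boundary values. **Theorem.** Let $\omega\in\mathrm{Rat}(\mathbb{T})$. Then $H(\overline{\mathbb{D}})\subset\mathrm{Dom}(T_\omega)$. If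 moreover $\omega$ is proper (that is, $\omega=s/q$ with coprime polynomials $s,q$ and $\deg s\le\deg q$), then $H(\overline{\mathbb{D}})$ is a core of $T_\omega$, that is, the graph of the restriction $T_\omega|_{H(\overline{\mathbb{D}})}$ is dense in the graph of $T_\omega$. -/

import Mathlib

open MeasureTheory AddCircle Filter Topology

namespace ToeplitzLike

/-! ### Rational functions -/

/-- Rational functions all of whose (finite) poles lie on the unit circle. The numerator and the
denominator of a `RatFunc` are coprime, so the poles are the roots of the denominator. -/
def PolesOnCircle (ω : RatFunc ℂ) : Prop :=
  ∀ z : ℂ, ω.denom.IsRoot z → ‖z‖ = 1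

/-- `ω = s / q` in lowest terms is proper if `deg s ≤ deg q`. -/
def IsProper (ω : RatFunc ℂ) : Prop :=
  ω.num.degree ≤ ω.denom.degree

/-- `ω = s / q` in lowest terms is strictly proper if `deg s < deg q`; this includes `ω = 0`. -/
def IsStrictlyProper (ω : RatFunc ℂ) : Prop :=
  ω.num.degree < ω.denom.degree

theorem IsStrictlyProper.add {ω ρ : RatFunc ℂ} (hω : IsStrictlyProper ω)
    (hρ : IsStrictlyProper ρ) : IsStrictlyProper (ω + ρ) := by
  unfold IsStrictlyProper at *
  have h := RatFunc.num_denom_add ω ρ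
  have h1 := ω.denom_ne_zero
  have h2 := ρ.denom_ne_zero
  have h3 := (ω + ρ).denom_ne_zero
  have hlt : (ω.num * ρ.denom + ω.denom * ρ.num).degree < (ω.denom * ρ.denom).degree := by
    refine lt_of_le_of_lt (Polynomial.degree_add_le _ _) (max_lt ?_ ?_)
    · rw [Polynomial.degree_mul, Polynomial.degree_mul]
      exact WithBot.add_lt_add_right (by simpa using h2) hω
    · rw [Polynomial.degree_mul, Polynomial.degree_mul]
      exact WithBot.add_lt_add_left (by simpa using h1) hρ
  by_contra! hc
  have h4 : (ω.num * ρ.denom + ω.denom * ρ.num).degree + (ω + ρ).denom.degree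
      < (ω.denom * ρ.denom).degree + (ω + ρ).num.degree :=
    lt_of_lt_of_le (WithBot.add_lt_add_right (by simpa using h3) hlt) (by gcongr)
  rw [← Polynomial.degree_mul, ← Polynomial.degree_mul, ← h, mul_comm] at h4
  exact lt_irrefl _ h4

theorem denom_C_mul_dvd (c : ℂ) (ρ : RatFunc ℂ) : (RatFunc.C c * ρ).denom ∣ ρ.denom := by
  simpa using RatFunc.denom_mul_dvd (RatFunc.C c) ρ

theorem IsStrictlyProper.C_mul (c : ℂ) {ρ : RatFunc ℂ} (hρ : IsStrictlyProper ρ) :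
    IsStrictlyProper (RatFunc.C c * ρ) := by
  unfold IsStrictlyProper at *
  have h := RatFunc.num_denom_mul (RatFunc.C c) ρ
  rw [RatFunc.num_C, RatFunc.denom_C, one_mul] at h
  have h3 := (RatFunc.C c * ρ).denom_ne_zero
  by_contra! hc
  have hlt : (Polynomial.C c * ρ.num).degree < ρ.denom.degree :=
    by
    refine lt_of_le_of_lt (Polynomial.degree_mul_le _ _) (lt_of_le_of_lt ?_ hρ)
    simpa using add_le_add_left (Polynomial.degree_C_le (a := c)) ρ.num.degree
  have h4 := lt_of_lt_of_le
    (WithBot.add_lt_add_right (z := (RatFunc.C c * ρ).denom.degree) (by simpa using h3) hlt)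
    (add_le_add_right hc ρ.denom.degree)
  rw [← Polynomial.degree_mul, ← Polynomial.degree_mul, ← h, mul_comm] at h4
  exact lt_irrefl _ h4

theorem PolesOnCircle.of_dvd {ω : RatFunc ℂ} {p : Polynomial ℂ}
    (h : ω.denom ∣ p) (hp : ∀ z : ℂ, p.IsRoot z → ‖z‖ = 1) : PolesOnCircle ω :=
  fun z hz => hp z (hz.dvd h)

theorem PolesOnCircle.add {ω ρ : RatFunc ℂ} (hω : PolesOnCircle ω) (hρ : PolesOnCircle ρ) :
    PolesOnCircle (ω + ρ) := by
  refine .of_dvd (RatFunc.denom_add_dvd ω ρ) fun z hz => ?_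
  rcases Polynomial.root_mul.1 hz with h | h
  exacts [hω z h, hρ z h]

/-! ### Lebesgue and Hardy space on the unit circle -/

/-- The point `exp (2 π i t)` of the unit circle. -/
noncomputable def circlePoint (t : UnitAddCircle) : ℂ := (toCircle t : ℂ)

/-- The space `L²` of the unit circle with normalised arc length. -/
abbrev L2 : Type := Lp ℂ 2 (haarAddCircle : Measure UnitAddCircle)

/-- The Hardy space `H²`, as the space of all `L²` functions on the circle whose Fourier
coefficients with negative index vanish. -/
noncomputable def H2 : Submodule ℂ L2 where
  carrier := {f | ∀ n : ℤ, n < 0 → fourierCoeff f n = 0}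
  zero_mem' n _ := by
    rw [← fourierBasis_repr]; simp
  add_mem' {f g} hf hg n hn := by
    have h1 := hf n hn
    have h2 := hg n hn
    rw [← fourierBasis_repr] at h1 h2 ⊢
    simp [h1, h2]
  smul_mem' c f hf n hn := by
    have h1 := hf n hn
    rw [← fourierBasis_repr] at h1 ⊢
    simp [h1]

theorem isClosed_H2 : IsClosed (H2 : Set L2) := by
  have : (H2 : Set L2) = ⋂ n : ℤ, ⋂ _ : n < 0,
      {f : L2 | inner ℂ (fourierBasis n : L2) f = 0} := by
    ext f
    simp only [Set.mem_iInter, Set.mem_ofPred_eq, ← HilbertBasis.repr_apply_apply, fourierBasis_repr]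
    rfl
  rw [this]
  refine isClosed_iInter fun n => isClosed_iInter fun _ => isClosed_eq ?_ continuous_const
  exact (innerSL ℂ _).continuous

instance : CompleteSpace H2 := isClosed_H2.completeSpace_coe

/-- The Riesz projection of `L²` onto `H²`; in the Hilbert space case it is the orthogonal
projection. -/
noncomputable def rieszProjection : L2 →L[ℂ] H2 := H2.orthogonalProjectionOnto

/-! ### Toeplitz-like operators -/

/-- The values of a rational function on the unit circle (with value `0` at the finitely many
poles). -/
noncomputable def boundaryValue (ω : RatFunc ℂ) (t : UnitAddCircle) : ℂ :=
  ω.eval (RingHom.id ℂ) (circlePoint t)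

theorem ae_eval_ne_zero {p : Polynomial ℂ} (hp : p ≠ 0) :
    ∀ᵐ t ∂(haarAddCircle : Measure UnitAddCircle), p.eval (circlePoint t) ≠ 0 := by
  have hfin : {t : UnitAddCircle | p.eval (circlePoint t) = 0}.Finite := by
    have : {t : UnitAddCircle | p.eval (circlePoint t) = 0} ⊆ circlePoint ⁻¹' {z | p.IsRoot z} :=
      fun t ht => ht
    refine ((Polynomial.finite_setOfPred_isRoot hp).preimage ?_).subset this
    intro a _ b _ hab
    exact injective_toCircle one_ne_zero (Subtype.ext hab)
  rw [ae_iff]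
  have : NullSingletonClass (haarAddCircle : Measure UnitAddCircle) := ⟨fun x => by
    have h := AddCircle.volume_closedBall (1 : ℝ) (x := x) 0
    rw [volume_eq_smul_haarAddCircle] at h
    simpa using h⟩
  simpa using hfin.measure_zero (haarAddCircle : Measure UnitAddCircle)

theorem ae_boundaryValue_add (ω ρ : RatFunc ℂ) :
    ∀ᵐ t ∂(haarAddCircle : Measure UnitAddCircle),
      boundaryValue (ω + ρ) t = boundaryValue ω t + boundaryValue ρ t := by
  filter_upwards [ae_eval_ne_zero ω.denom_ne_zero, ae_eval_ne_zero ρ.denom_ne_zero] with t h1 h2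
  exact RatFunc.eval_add _ _ (by simpa using h1) (by simpa using h2)

theorem ae_boundaryValue_C_mul (c : ℂ) (ρ : RatFunc ℂ) :
    ∀ᵐ t ∂(haarAddCircle : Measure UnitAddCircle),
      boundaryValue (RatFunc.C c * ρ) t = c * boundaryValue ρ t := by
  filter_upwards [ae_eval_ne_zero ρ.denom_ne_zero] with t h1
  have := RatFunc.eval_mul (RingHom.id ℂ) (circlePoint t) (x := RatFunc.C c) (y := ρ)
    (by simp) (by simpa using h1)
  simpa [boundaryValue] using this

/-- The graph of the Toeplitz-like operator with symbol `ω`: all pairs `(g, P f)` with `g ∈ H²`,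
`f ∈ L²` and `ω g = f + ρ` almost everywhere on the circle for some strictly proper rational
function `ρ` with poles only on the circle. -/
noncomputable def toeplitzGraph (ω : RatFunc ℂ) : Submodule ℂ (H2 × H2) where
  carrier := {p | ∃ (f : L2) (ρ : RatFunc ℂ), IsStrictlyProper ρ ∧ PolesOnCircle ρ ∧
    (∀ᵐ t ∂(haarAddCircle : Measure UnitAddCircle),
      boundaryValue ω t * (p.1 : L2) t = f t + boundaryValue ρ t) ∧
    p.2 = rieszProjection f}
  zero_mem' := by
    refine ⟨0, 0, by simp [IsStrictlyProper], by simp [PolesOnCircle, Polynomial.IsRoot], ?_,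
      by simp⟩
    filter_upwards [Lp.coeFn_zero ℂ 2 (haarAddCircle : Measure UnitAddCircle)] with t _
    simp [boundaryValue]
  add_mem' := by
    rintro ⟨g₁, h₁⟩ ⟨g₂, h₂⟩ ⟨f₁, ρ₁, hs₁, hp₁, he₁, rfl⟩ ⟨f₂, ρ₂, hs₂, hp₂, he₂, rfl⟩
    refine ⟨f₁ + f₂, ρ₁ + ρ₂, hs₁.add hs₂, hp₁.add hp₂, ?_, by simp⟩
    filter_upwards [he₁, he₂, Lp.coeFn_add f₁ f₂, Lp.coeFn_add (g₁ : L2) (g₂ : L2),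
      ae_boundaryValue_add ρ₁ ρ₂] with t a1 a2 a3 a4 a5
    simp only [Prod.mk_add_mk, Submodule.coe_add, a3, a4, a5, Pi.add_apply, mul_add] at a1 a2 ⊢
    rw [a1, a2]; ring
  smul_mem' := by
    rintro c ⟨g, h⟩ ⟨f, ρ, hs, hp, he, rfl⟩
    refine ⟨c • f, RatFunc.C c * ρ, hs.C_mul c, .of_dvd (denom_C_mul_dvd c ρ) hp, ?_, by simp⟩
    filter_upwards [he, Lp.coeFn_smul c f, Lp.coeFn_smul c (g : L2),
      ae_boundaryValue_C_mul c ρ] with t a1 a2 a3 a4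
    simp only [Prod.smul_mk, Submodule.coe_smul, a2, a3, a4, Pi.smul_apply, smul_eq_mul] at a1 ⊢
    rw [mul_left_comm, a1, mul_add]

theorem hasDerivAt_circlePoint (x : ℝ) :
    HasDerivAt (fun y : ℝ => circlePoint (y : UnitAddCircle))
      (2 * Real.pi * Complex.I * circlePoint (x : UnitAddCircle)) x := by
  have := hasDerivAt_fourier (1 : ℝ) 1 x
  simpa [circlePoint] using this

theorem circlePoint_surj {z : ℂ} (hz : ‖z‖ = 1) : ∃ x : ℝ, circlePoint (x : UnitAddCircle) = z := by
  refine ⟨z.arg / (2 * Real.pi), ?_⟩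
  have : 2 * Real.pi / 1 * (z.arg / (2 * Real.pi)) = z.arg := by field_simp
  rw [circlePoint, toCircle_apply_mk, this, Circle.coe_exp]
  simpa [hz] using Complex.norm_mul_exp_arg_mul_I z

/-- A strictly proper rational function with poles on the circle that is square integrable on the
circle is zero. -/
theorem eq_zero_of_boundaryValue_ae_eq {ρ : RatFunc ℂ} (hs : IsStrictlyProper ρ)
    (hp : PolesOnCircle ρ) (f : L2)
    (h : ∀ᵐ t ∂(haarAddCircle : Measure UnitAddCircle), boundaryValue ρ t = f t) : ρ = 0 := by
  by_cases hdeg : ρ.denom.degree = 0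
  · rw [IsStrictlyProper, hdeg] at hs
    rw [← RatFunc.num_eq_zero_iff]
    by_contra hne
    exact absurd hs (not_lt.2 (Polynomial.zero_le_degree_iff.2 hne))
  exfalso
  obtain ⟨z, hz⟩ := Complex.exists_root (Polynomial.degree_pos_of_ne_zero_of_nonunit ρ.denom_ne_zero
    (fun hu => hdeg (Polynomial.degree_eq_zero_of_isUnit hu)))
  obtain ⟨x, hx⟩ := circlePoint_surj (hp z hz)
  obtain ⟨b, hb⟩ := Polynomial.dvd_iff_isRoot.2 hz
  have hnum : ρ.num.eval z ≠ 0 := by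
    intro h0
    obtain ⟨u, v, huv⟩ := RatFunc.isCoprime_num_denom ρ
    have := congrArg (Polynomial.eval z) huv
    simp [h0, show ρ.denom.eval z = 0 from hz] at this
  -- integrability of the boundary values
  have hint : Integrable (boundaryValue ρ) (volume : Measure UnitAddCircle) := by
    have hf : Integrable f (haarAddCircle : Measure UnitAddCircle) :=
      (Lp.memLp f).integrable (by norm_num)
    have := hf.congr (h.mono fun t ht => ht.symm)
    rw [volume_eq_smul_haarAddCircle]
    exact this.smul_measure (by simp)
  have hii : IntervalIntegrable (fun y : ℝ => boundaryValue ρ (y : UnitAddCircle)) volume x (x + 1) := by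
    rw [intervalIntegrable_iff_integrableOn_Ioc_of_le (by linarith)]
    exact (UnitAddCircle.measurePreserving_mk x).integrable_comp_of_integrable hint
  refine not_intervalIntegrable_of_sub_inv_isBigO_punctured (c := x) ?_ (by linarith)
    (Set.left_mem_uIcc) hii
  have hd := hasDerivAt_circlePoint x
  have hcont : ContinuousAt (fun y : ℝ => circlePoint (y : UnitAddCircle)) x := hd.continuousAt
  have hO1 : (fun y : ℝ => circlePoint (y : UnitAddCircle) - z) =O[𝓝[≠] x] fun y => y - x := by
    have := hd.differentiableAt.isBigO_sub
    rw [hx] at this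
    exact this.mono nhdsWithin_le_nhds
  have hne : ∀ᶠ y : ℝ in 𝓝[≠] x, circlePoint (y : UnitAddCircle) ≠ z := by
    have := hd.eventually_ne (c := z) (by rw [hx]; simp [← norm_ne_zero_iff, hp z hz, Real.pi_ne_zero])
    exact this
  have hO2 : (fun y : ℝ => (y - x)⁻¹) =O[𝓝[≠] x]
      fun y : ℝ => (circlePoint (y : UnitAddCircle) - z)⁻¹ := by
    refine hO1.inv_rev ?_
    filter_upwards [hne] with y hy h0
    exact absurd h0 (sub_ne_zero.2 hy)
  refine hO2.trans ?_
  have hcq : ContinuousAt (fun y : ℝ => b.eval (circlePoint (y : UnitAddCircle)) /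
      ρ.num.eval (circlePoint (y : UnitAddCircle))) x := by
    refine ContinuousAt.div (b.continuous.continuousAt.comp hcont)
      (ρ.num.continuous.continuousAt.comp hcont) (by rwa [hx])
  have hO3 : (fun y : ℝ => b.eval (circlePoint (y : UnitAddCircle)) /
      ρ.num.eval (circlePoint (y : UnitAddCircle)) * boundaryValue ρ (y : UnitAddCircle)) =O[𝓝[≠] x]
      fun y : ℝ => (1 : ℂ) * boundaryValue ρ (y : UnitAddCircle) :=
    ((hcq.tendsto.mono_left nhdsWithin_le_nhds).isBigO_one ℂ).mul
      (Asymptotics.isBigO_refl _ _)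
  simp only [one_mul] at hO3
  refine hO3.congr' ?_ EventuallyEq.rfl |>.trans (Asymptotics.isBigO_refl _ _)
  have hnum' : ∀ᶠ y : ℝ in 𝓝[≠] x, ρ.num.eval (circlePoint (y : UnitAddCircle)) ≠ 0 :=
    ((ρ.num.continuous.continuousAt.comp hcont).eventually_ne
      (by simpa [hx] using hnum)).filter_mono nhdsWithin_le_nhds
  have hb' : ∀ᶠ y : ℝ in 𝓝[≠] x, b.eval (circlePoint (y : UnitAddCircle)) ≠ 0 := by
    have hb0 : b ≠ 0 := fun h0 => ρ.denom_ne_zero (by rw [hb, h0, mul_zero])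
    have hfin : ({w | b.IsRoot w} \ {z}).Finite := (Polynomial.finite_setOfPred_isRoot hb0).sdiff
    have hmem : ({w | b.IsRoot w} \ {z})ᶜ ∈ 𝓝 (circlePoint (x : UnitAddCircle)) :=
      hfin.isClosed.isOpen_compl.mem_nhds (by simp [hx])
    filter_upwards [hne, nhdsWithin_le_nhds (hcont hmem)] with y h1 h2 h3
    exact h2 ⟨h3, h1⟩
  filter_upwards [hnum', hb', hne] with y h1 h2 h3
  have h4 := sub_ne_zero.2 h3
  simp only [boundaryValue, RatFunc.eval, Polynomial.eval₂_id]
  rw [hb]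
  simp only [Polynomial.eval_mul, Polynomial.eval_sub, Polynomial.eval_X, Polynomial.eval_C]
  field_simp

/-- The graph relation is single valued: `f` and `ρ` are determined by `g`. -/
theorem toeplitzGraph_snd_eq_zero (ω : RatFunc ℂ) (p : H2 × H2) (hp : p ∈ toeplitzGraph ω)
    (h0 : p.1 = 0) : p.2 = 0 := by
  obtain ⟨f, ρ, hs, hpo, he, h2⟩ := hp
  have hρ : ρ = 0 := by
    refine eq_zero_of_boundaryValue_ae_eq hs hpo (-f) ?_
    filter_upwards [he, Lp.coeFn_neg f, Lp.coeFn_zero ℂ 2 (haarAddCircle : Measure UnitAddCircle)]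
      with t a1 a2 a3
    rw [h0, ZeroMemClass.coe_zero, a3] at a1
    rw [a2, Pi.neg_apply, eq_neg_iff_add_eq_zero, add_comm, ← a1]
    simp
  have hf : f = 0 := by
    rw [Lp.eq_zero_iff_ae_eq_zero]
    filter_upwards [he, Lp.coeFn_zero ℂ 2 (haarAddCircle : Measure UnitAddCircle)] with t a1 a3
    rw [h0, ZeroMemClass.coe_zero, a3, hρ] at a1
    simpa [boundaryValue] using a1.symm
  rw [h2, hf, map_zero]

/-- The Toeplitz-like operator `T_ω` on `H²`, a partially defined linear operator: its domain
consists of all `g ∈ H²` with `ω g = f + ρ` on the circle, where `f ∈ L²` and `ρ` is strictly proper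
with poles only on the circle, and `T_ω g = P f`. -/
noncomputable def toeplitz (ω : RatFunc ℂ) : H2 →ₗ.[ℂ] H2 :=
  (toeplitzGraph ω).toLinearPMap

theorem toeplitz_graph (ω : RatFunc ℂ) : (toeplitz ω).graph = toeplitzGraph ω :=
  Submodule.toLinearPMap_graph_eq _ (toeplitzGraph_snd_eq_zero ω)

theorem mem_toeplitz_domain_iff (ω : RatFunc ℂ) (g : H2) :
    g ∈ (toeplitz ω).domain ↔ ∃ (f : L2) (ρ : RatFunc ℂ), IsStrictlyProper ρ ∧ PolesOnCircle ρ ∧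
      ∀ᵐ t ∂(haarAddCircle : Measure UnitAddCircle),
        boundaryValue ω t * (g : L2) t = f t + boundaryValue ρ t := by
  constructor
  · rintro ⟨⟨_, h⟩, ⟨f, ρ, h1, h2, h3, _⟩, rfl⟩
    exact ⟨f, ρ, h1, h2, h3⟩
  · rintro ⟨f, ρ, h1, h2, h3⟩
    exact ⟨(g, rieszProjection f), ⟨f, ρ, h1, h2, h3, rfl⟩, rfl⟩

/-! ### Functions analytic near the closed disc, and cores -/

/-- The space of (boundary values of) functions analytic on a neighbourhood of the closed unit
disc, as a subspace of `H²`. -/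
noncomputable def analyticClosedDisc : Submodule ℂ H2 where
  carrier := {g | ∃ F : ℂ → ℂ, AnalyticOnNhd ℂ F (Metric.closedBall 0 1) ∧
    ∀ᵐ t ∂(haarAddCircle : Measure UnitAddCircle), (g : L2) t = F (circlePoint t)}
  zero_mem' := by
    refine ⟨0, fun z _ => analyticAt_const, ?_⟩
    filter_upwards [Lp.coeFn_zero ℂ 2 (haarAddCircle : Measure UnitAddCircle)] with t ht
    simp
  add_mem' := by
    rintro g₁ g₂ ⟨F₁, hF₁, h₁⟩ ⟨F₂, hF₂, h₂⟩
    refine ⟨F₁ + F₂, hF₁.add hF₂, ?_⟩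
    filter_upwards [h₁, h₂, Lp.coeFn_add (g₁ : L2) (g₂ : L2)] with t a1 a2 a3
    rw [Submodule.coe_add, a3, Pi.add_apply, a1, a2, Pi.add_apply]
  smul_mem' := by
    rintro c g ⟨F, hF, h⟩
    refine ⟨c • F, hF.const_smul, ?_⟩
    filter_upwards [h, Lp.coeFn_smul c (g : L2)] with t a1 a2
    rw [Submodule.coe_smul, a2, Pi.smul_apply, a1, Pi.smul_apply]

/-- Every function analytic on a neighbourhood of the closed disc has its boundary values in
`H²`. -/
theorem exists_mem_analyticClosedDisc {F : ℂ → ℂ}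
    (hF : AnalyticOnNhd ℂ F (Metric.closedBall 0 1)) :
    ∃ g ∈ analyticClosedDisc, ∀ᵐ t ∂(haarAddCircle : Measure UnitAddCircle),
      ((g : H2) : L2) t = F (circlePoint t) := by
  have hmem : ∀ t : UnitAddCircle, circlePoint t ∈ Metric.closedBall (0 : ℂ) 1 := fun t => by
    rw [mem_closedBall_zero_iff]; exact (Circle.norm_coe _).le
  have hcp : Continuous circlePoint := continuous_subtype_val.comp continuous_toCircle
  let φ : C(UnitAddCircle, ℂ) := ⟨fun t => F (circlePoint t),
    hF.continuousOn.comp_continuous hcp hmem⟩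
  let f : L2 := ContinuousMap.toLp (E := ℂ) 2 haarAddCircle ℂ φ
  have hf : ∀ᵐ t ∂(haarAddCircle : Measure UnitAddCircle), f t = F (circlePoint t) :=
    ContinuousMap.coeFn_toLp haarAddCircle φ
  have hfH : f ∈ H2 := by
    intro n hn
    obtain ⟨k, hk⟩ : ∃ k : ℕ, -n = k + 1 := ⟨(-n - 1).toNat, by omega⟩
    rw [fourierCoeff_toLp, fourierCoeff_eq_intervalIntegral _ _ 0]
    have hC : ∮ z in C(0, 1), z ^ k * F z = 0 := by
      refine Complex.circleIntegral_eq_zero_of_differentiable_on_off_countable zero_le_one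
        Set.countable_empty ?_ ?_
      · exact (continuous_pow k).continuousOn.mul hF.continuousOn
      · intro z hz
        exact (differentiableAt_pow k).mul
          (hF z (Metric.ball_subset_closedBall hz.1)).differentiableAt
    have hsub := intervalIntegral.integral_comp_mul_left (a := 0) (b := 1)
      (fun θ : ℝ => deriv (circleMap 0 1) θ • (circleMap 0 1 θ ^ k * F (circleMap 0 1 θ)))
      (c := 2 * Real.pi) (by positivity)
    rw [mul_zero, mul_one] at hsub
    rw [circleIntegral] at hC
    rw [hC, smul_zero] at hsub
    have hpt : ∀ x : ℝ, deriv (circleMap 0 1) (2 * Real.pi * x) •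
        (circleMap 0 1 (2 * Real.pi * x) ^ k * F (circleMap 0 1 (2 * Real.pi * x))) =
        Complex.I * (fourier (-n) (x : UnitAddCircle) • φ (x : UnitAddCircle)) := by
      intro x
      have hw : circleMap 0 1 (2 * Real.pi * x) = circlePoint (x : UnitAddCircle) := by
        simp [circleMap, circlePoint, toCircle_apply_mk, Circle.coe_exp]
      have hfo : fourier (-n) (x : UnitAddCircle) = circlePoint (x : UnitAddCircle) ^ (k + 1) := by
        rw [hk, fourier_apply, toCircle_zsmul, circlePoint]
        norm_cast
      rw [deriv_circleMap, hw, hfo]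
      simp only [φ, ContinuousMap.coe_mk, smul_eq_mul]
      ring
    simp only [hpt] at hsub
    rw [intervalIntegral.integral_const_mul] at hsub
    have := (mul_eq_zero.1 hsub).resolve_left Complex.I_ne_zero
    rw [zero_add, this, smul_zero]
  exact ⟨⟨f, hfH⟩, ⟨F, hF, hf⟩, hf⟩

/-- A subspace `D` of the domain of `T` is a core of `T` if the graph of the restriction of `T` to
`D` is dense in the graph of `T`. -/
structure IsCore {H : Type*} [NormedAddCommGroup H] [InnerProductSpace ℂ H]
    (T : H →ₗ.[ℂ] H) (D : Submodule ℂ H) : Prop where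
  le_domain : D ≤ T.domain
  graph_subset_closure :
    (T.graph : Set (H × H)) ⊆ closure ((T.domRestrict D).graph : Set (H × H))

end ToeplitzLike

namespace ToeplitzLike

/-! Write ω = s/q in lowest terms; all roots of q lie on the circle. For F analytic near the closed
disc, division by q gives sF = qG + r with G analytic there and deg r < deg q, so ωF = G + r/q on
the circle and F lies in the domain (`exists_analyticOnNhd_eq_mul_add`).

For the core property, the domain is contained in qH² + polynomials
(`exists_sub_mulPolyH2_mem_analyticClosedDisc`). Indeed, if ωg = f + ρ and us + vq = 1, then k = uf
+ vg satisfies g - qk = quρ. This rational function is square integrable on the circle with poles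
only there, hence a polynomial. So qk lies in H², and then so does k, since dividing by a factor X -
a with |a| = 1 does not leave H² (`mem_H2_of_mulPoly_X_sub_C_mem`).

On qH² the operator acts by qk ↦ sk, and both k ↦ qk and k ↦ sk are bounded. Approximating k in H²
by polynomials therefore approximates (qk, sk) in the graph norm, while the remaining part g - qk is
a polynomial and needs no approximation. -/

open Polynomial in
/-- Induction along the linear factors of a nonzero polynomial with all its roots on the unit
circle. -/
theorem polynomial_induction_of_roots_on_circle {P : ℂ[X] → Prop} (hC : ∀ c ≠ 0, P (C c))
    (hmul : ∀ (a : ℂ) (q : ℂ[X]), ‖a‖ = 1 → P q → P ((X - C a) * q)) (q : ℂ[X]) (hq : q ≠ 0)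
    (hroots : ∀ z : ℂ, q.IsRoot z → ‖z‖ = 1) : P q := by
  induction h : q.natDegree generalizing q with
  | zero =>
    obtain ⟨c, rfl⟩ := natDegree_eq_zero.1 h
    exact hC c (by simpa using hq)
  | succ n ih =>
    obtain ⟨a, ha⟩ := Complex.exists_root (f := q) (natDegree_pos_iff_degree_pos.1 (by omega))
    obtain ⟨b, rfl⟩ := dvd_iff_isRoot.2 ha
    have hb : b ≠ 0 := right_ne_zero_of_mul hq
    refine hmul a b (hroots a ha) (ih b hb (fun z hz => hroots z (root_mul.2 (.inr hz))) ?_)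
    rw [natDegree_mul (X_sub_C_ne_zero a) hb, natDegree_X_sub_C] at h
    omega

/-! ### Rational functions in terms of polynomials -/

/-- Cancelling common factors preserves the difference of degrees, so n/d need not be in lowest
terms. -/
theorem isStrictlyProper_div {n d : Polynomial ℂ} (h : n.degree < d.degree) :
    IsStrictlyProper (algebraMap _ (RatFunc ℂ) n / algebraMap _ (RatFunc ℂ) d) := by
  have hd : d ≠ 0 := Polynomial.ne_zero_of_degree_gt h
  set ρ := algebraMap _ (RatFunc ℂ) n / algebraMap _ (RatFunc ℂ) d
  have he : ρ.num * d = n * ρ.denom := by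
    rw [RatFunc.num_mul_eq_mul_denom_iff hd]
  unfold IsStrictlyProper
  by_contra! hc
  have h2 : n.degree + ρ.denom.degree < d.degree + ρ.num.degree :=
    lt_of_lt_of_le (WithBot.add_lt_add_right (by simpa using ρ.denom_ne_zero) h) (by gcongr)
  rw [← Polynomial.degree_mul, ← Polynomial.degree_mul, ← he, mul_comm] at h2
  exact lt_irrefl _ h2

theorem polesOnCircle_div (n : Polynomial ℂ) {d : Polynomial ℂ}
    (hd : ∀ z : ℂ, d.IsRoot z → ‖z‖ = 1) :
    PolesOnCircle (algebraMap _ (RatFunc ℂ) n / algebraMap _ (RatFunc ℂ) d) :=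
  .of_dvd (RatFunc.denom_div_dvd n d) hd

theorem boundaryValue_eq_div (ω : RatFunc ℂ) (t : UnitAddCircle) :
    boundaryValue ω t = ω.num.eval (circlePoint t) / ω.denom.eval (circlePoint t) := by
  simp [boundaryValue, RatFunc.eval, Polynomial.eval₂_id]

/-- `boundaryValue` evaluates the reduced fraction; the two quotients can differ only at the
finitely many zeros of d. -/
theorem ae_boundaryValue_div (n : Polynomial ℂ) {d : Polynomial ℂ} (hd : d ≠ 0) :
    ∀ᵐ t ∂(haarAddCircle : Measure UnitAddCircle),
      boundaryValue (algebraMap _ (RatFunc ℂ) n / algebraMap _ (RatFunc ℂ) d) t =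
        n.eval (circlePoint t) / d.eval (circlePoint t) := by
  set ρ := algebraMap _ (RatFunc ℂ) n / algebraMap _ (RatFunc ℂ) d
  have he : ρ.num * d = n * ρ.denom := by
    rw [RatFunc.num_mul_eq_mul_denom_iff hd]
  filter_upwards [ae_eval_ne_zero hd, ae_eval_ne_zero ρ.denom_ne_zero] with t h1 h2
  rw [boundaryValue_eq_div, div_eq_div_iff h2 h1, ← Polynomial.eval_mul, he, Polynomial.eval_mul]

/-! ### Multiplication by polynomials on `L²` -/

theorem continuous_circlePoint : Continuous circlePoint :=
  continuous_subtype_val.comp continuous_toCircle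

/-- The bounded operator on `L²` of multiplication by a polynomial. -/
noncomputable def mulPoly (p : Polynomial ℂ) : L2 →L[ℂ] L2 :=
  (ContinuousLinearMap.mul ℂ ℂ).holderL haarAddCircle ⊤ 2 2
    (ContinuousMap.toLp (E := ℂ) ⊤ haarAddCircle ℂ
      ⟨fun t => p.eval (circlePoint t), p.continuous.comp continuous_circlePoint⟩)

theorem coeFn_mulPoly (p : Polynomial ℂ) (k : L2) :
    ∀ᵐ t ∂(haarAddCircle : Measure UnitAddCircle),
      mulPoly p k t = p.eval (circlePoint t) * k t := by
  set φ : C(UnitAddCircle, ℂ) :=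
    ⟨fun t => p.eval (circlePoint t), p.continuous.comp continuous_circlePoint⟩
  filter_upwards [(ContinuousLinearMap.mul ℂ ℂ).coeFn_holder (r := 2)
    (ContinuousMap.toLp (E := ℂ) ⊤ haarAddCircle ℂ φ) k,
    ContinuousMap.coeFn_toLp (p := ⊤) (𝕜 := ℂ) haarAddCircle φ] with t h1 h2
  rw [mulPoly, ContinuousLinearMap.holderL_apply_apply, h1, h2]
  simp [φ]

theorem mulPoly_add (p q : Polynomial ℂ) (k : L2) :
    mulPoly (p + q) k = mulPoly p k + mulPoly q k := by
  refine Lp.ext ?_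
  filter_upwards [coeFn_mulPoly (p + q) k, coeFn_mulPoly p k, coeFn_mulPoly q k,
    Lp.coeFn_add (mulPoly p k) (mulPoly q k)] with t h1 h2 h3 h4
  rw [h1, h4, Pi.add_apply, h2, h3, Polynomial.eval_add, add_mul]

theorem mulPoly_mul (p q : Polynomial ℂ) (k : L2) :
    mulPoly (p * q) k = mulPoly p (mulPoly q k) := by
  refine Lp.ext ?_
  filter_upwards [coeFn_mulPoly (p * q) k, coeFn_mulPoly p (mulPoly q k), coeFn_mulPoly q k]
    with t h1 h2 h3
  rw [h1, h2, h3, Polynomial.eval_mul, mul_assoc]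

theorem mulPoly_C (c : ℂ) (k : L2) : mulPoly (Polynomial.C c) k = c • k := by
  refine Lp.ext ?_
  filter_upwards [coeFn_mulPoly (Polynomial.C c) k, Lp.coeFn_smul c k] with t h1 h2
  rw [h1, h2, Polynomial.eval_C, Pi.smul_apply, smul_eq_mul]

theorem fourierCoeff_mulPoly_X (k : L2) (n : ℤ) :
    fourierCoeff (mulPoly Polynomial.X k) n = fourierCoeff k (n - 1) := by
  rw [fourierCoeff, fourierCoeff]
  refine integral_congr_ae ?_
  filter_upwards [coeFn_mulPoly Polynomial.X k] with t ht
  have : fourier (-(n - 1)) t = fourier (-n) t * circlePoint t := by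
    rw [neg_sub', sub_neg_eq_add, fourier_add, fourier_one, circlePoint]
  rw [ht, this, Polynomial.eval_X, smul_eq_mul, smul_eq_mul, mul_assoc]

theorem mulPoly_mem_H2 (p : Polynomial ℂ) {k : L2} (hk : k ∈ H2) : mulPoly p k ∈ H2 := by
  induction p using Polynomial.induction_on with
  | C c => rw [mulPoly_C]; exact H2.smul_mem c hk
  | add p q hp hq => rw [mulPoly_add]; exact H2.add_mem hp hq
  | monomial n c h =>
    rw [pow_succ, ← mul_assoc, mul_comm, mulPoly_mul]
    intro m hm
    rw [fourierCoeff_mulPoly_X]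
    exact h _ (by omega)

/-- The vanishing negative coefficients of (X - a)k give a recursion under which the negative
coefficients of k all have the same modulus; square summability forces that modulus to be zero. -/
theorem mem_H2_of_mulPoly_X_sub_C_mem {a : ℂ} (ha : ‖a‖ = 1) {k : L2}
    (h : mulPoly (Polynomial.X - Polynomial.C a) k ∈ H2) : k ∈ H2 := by
  have hrec : ∀ n : ℤ, n < 0 → fourierCoeff k (n - 1) = a * fourierCoeff k n := by
    intro n hn
    have h1 := h n hn
    rw [sub_eq_add_neg, ← Polynomial.C_neg, mulPoly_add, mulPoly_C, ← fourierBasis_repr, map_add,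
      map_smul, lp.coeFn_add, lp.coeFn_smul, Pi.add_apply, Pi.smul_apply, fourierBasis_repr,
      fourierBasis_repr, fourierCoeff_mulPoly_X, smul_eq_mul] at h1
    linear_combination h1
  intro n hn
  have hnorm : ∀ m : ℕ, ‖fourierCoeff k (n - m)‖ = ‖fourierCoeff k n‖ := by
    intro m
    induction m with
    | zero => simp
    | succ m ih =>
      rw [← ih, Nat.cast_succ, ← sub_sub, hrec _ (by omega), norm_mul, ha, one_mul]
  have hsum : Summable fun m : ℤ => ‖fourierCoeff k m‖ ^ (2 : ℝ) := by
    have := (lp.memℓp (fourierBasis.repr k)).summable (by norm_num)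
    simpa [fourierBasis_repr] using this
  -- Along n, n - 1, n - 2, ... the summands are constant, yet they tend to zero.
  have hlim := hsum.comp_injective (i := fun m : ℕ => n - m) (fun x y hxy => by simpa using hxy)
    |>.tendsto_atTop_zero
  simp only [Function.comp_def, hnorm] at hlim
  simpa using tendsto_nhds_unique tendsto_const_nhds hlim

theorem mem_H2_of_mulPoly_mem {q : Polynomial ℂ} (hq : q ≠ 0)
    (hroots : ∀ z : ℂ, q.IsRoot z → ‖z‖ = 1) {k : L2} (h : mulPoly q k ∈ H2) : k ∈ H2 := by
  refine polynomial_induction_of_roots_on_circle (P := fun q => mulPoly q k ∈ H2 → k ∈ H2)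
    ?_ ?_ q hq hroots h
  · intro c hc h
    rw [mulPoly_C] at h
    exact (H2.smul_mem_iff hc).1 h
  · intro a q ha ih h
    rw [mulPoly_mul] at h
    exact ih (mem_H2_of_mulPoly_X_sub_C_mem ha h)

/-- Multiplication by a polynomial as a bounded operator on `H²`. -/
noncomputable def mulPolyH2 (p : Polynomial ℂ) : H2 →L[ℂ] H2 :=
  ((mulPoly p).comp H2.subtypeL).codRestrict H2 fun k => mulPoly_mem_H2 p k.2

theorem coe_mulPolyH2 (p : Polynomial ℂ) (k : H2) : (mulPolyH2 p k : L2) = mulPoly p k := rfl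

/-! ### Functions analytic near the closed disc -/

/-- At a itself the power series of F is shifted by one; elsewhere the slope is locally an ordinary
quotient. -/
theorem analyticAt_dslope {F : ℂ → ℂ} {a z : ℂ} (ha : AnalyticAt ℂ F a) (hz : AnalyticAt ℂ F z) :
    AnalyticAt ℂ (dslope F a) z := by
  rcases eq_or_ne z a with rfl | hne
  · obtain ⟨p, hp⟩ := ha
    exact ⟨_, hp.has_fpower_series_dslope_fslope⟩
  · have h : AnalyticAt ℂ (fun w => (F w - F a) / (w - a)) z :=
      (hz.sub analyticAt_const).div (analyticAt_id.sub analyticAt_const) (sub_ne_zero.2 hne)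
    refine h.congr ?_
    filter_upwards [eventually_ne_nhds hne] with w hw
    rw [dslope_of_ne _ hw, slope_def_field]

theorem analyticOnNhd_polynomial_eval (p : Polynomial ℂ) (s : Set ℂ) :
    AnalyticOnNhd ℂ (fun z => p.eval z) s := fun z _ => by
  simpa using (AnalyticAt.aeval_polynomial (𝕜 := ℂ) (analyticAt_id (z := z)) p)

/-- Division with polynomial remainder of a function analytic near the closed disc by a polynomial
with roots on the circle. -/
theorem exists_analyticOnNhd_eq_mul_add {q : Polynomial ℂ} (hq : q ≠ 0)
    (hroots : ∀ z : ℂ, q.IsRoot z → ‖z‖ = 1) {F : ℂ → ℂ}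
    (hF : AnalyticOnNhd ℂ F (Metric.closedBall 0 1)) :
    ∃ (G : ℂ → ℂ) (r : Polynomial ℂ), AnalyticOnNhd ℂ G (Metric.closedBall 0 1) ∧
      r.degree < q.degree ∧ ∀ z, F z = q.eval z * G z + r.eval z := by
  obtain ⟨G, r, hG, hr⟩ : ∃ (G : ℂ → ℂ) (r : Polynomial ℂ),
      AnalyticOnNhd ℂ G (Metric.closedBall 0 1) ∧ ∀ z, F z = q.eval z * G z + r.eval z := by
    refine polynomial_induction_of_roots_on_circle (P := fun q => ∃ (G : ℂ → ℂ) (r : Polynomial ℂ),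
      AnalyticOnNhd ℂ G (Metric.closedBall 0 1) ∧ ∀ z, F z = q.eval z * G z + r.eval z)
      ?_ ?_ q hq hroots
    · intro c hc
      refine ⟨fun z => c⁻¹ * F z, 0, fun z hz => analyticAt_const.mul (hF z hz), fun z => ?_⟩
      simp [hc]
    · rintro a q ha ⟨G, r, hG, hr⟩
      -- Substitute G(z) = G(a) + (z - a) · `dslope G a z` into F = qG + r.
      refine ⟨dslope G a, Polynomial.C (G a) * q + r,
        fun z hz => analyticAt_dslope (hG a (by simp [ha])) (hG z hz), fun z => ?_⟩
      have h := sub_smul_dslope G a z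
      rw [smul_eq_mul] at h
      rw [hr z]
      simp only [Polynomial.eval_mul, Polynomial.eval_sub, Polynomial.eval_X, Polynomial.eval_C,
        Polynomial.eval_add]
      linear_combination (-q.eval z) * h
  -- The degree bound comes from reducing r modulo q; the polynomial quotient is absorbed into G.
  refine ⟨fun z => G z + (r / q).eval z, r % q, fun z hz => (hG z hz).add ?_,
    Polynomial.degree_mod_lt r hq, fun z => ?_⟩
  · exact analyticOnNhd_polynomial_eval (r / q) _ z hz
  · have := congrArg (Polynomial.eval z) (EuclideanDomain.div_add_mod r q)
    rw [Polynomial.eval_add, Polynomial.eval_mul] at this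
    rw [hr z, ← this]
    ring

theorem mulPolyH2_mem_analyticClosedDisc (p : Polynomial ℂ) {k : H2}
    (hk : k ∈ analyticClosedDisc) : mulPolyH2 p k ∈ analyticClosedDisc := by
  obtain ⟨F, hF, h⟩ := hk
  refine ⟨fun z => p.eval z * F z, (analyticOnNhd_polynomial_eval p _).mul hF, ?_⟩
  filter_upwards [h, coeFn_mulPoly p k] with t h1 h2
  rw [coe_mulPolyH2, h2, h1]

/-- The functions analytic near the closed disc are dense in `H²`. -/
theorem mem_closure_analyticClosedDisc (k : H2) :
    k ∈ closure (analyticClosedDisc : Set H2) := by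
  -- The Fourier series converges in the ambient L², so the closure is taken there; for k in H² its
  -- partial sums are polynomials.
  rw [closure_subtype]
  refine mem_closure_of_tendsto (hasSum_fourier_series_L2 (k : L2)) (.of_forall fun s => ?_)
  have hmem : ∀ n : ℤ, fourierCoeff (k : L2) n • (fourierLp 2 n : L2) ∈
      analyticClosedDisc.map H2.subtype := by
    intro n
    rcases lt_or_ge n 0 with hn | hn
    · rw [k.2 n hn, zero_smul]
      exact zero_mem _
    · refine Submodule.smul_mem _ _ ?_
      lift n to ℕ using hn
      obtain ⟨g, hg, hgF⟩ := exists_mem_analyticClosedDisc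
        (analyticOnNhd_polynomial_eval (Polynomial.X ^ n) (Metric.closedBall 0 1))
      refine ⟨g, hg, Lp.ext ?_⟩
      filter_upwards [hgF, coeFn_fourierLp (T := 1) 2 n] with t h1 h2
      rw [h2, Submodule.subtype_apply, h1]
      simp [fourier_apply, toCircle_nsmul, circlePoint]
  obtain ⟨g, hg, hgs⟩ := Submodule.sum_mem (t := s) _ fun n _ => hmem n
  exact ⟨g, hg, hgs⟩

/-! ### The domain of the Toeplitz-like operator -/

theorem mem_toeplitz_domain_of_mem_analyticClosedDisc {ω : RatFunc ℂ} (hω : PolesOnCircle ω) {g : H2}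
    (hg : g ∈ analyticClosedDisc) : g ∈ (toeplitz ω).domain := by
  obtain ⟨F, hF, hgF⟩ := hg
  obtain ⟨G, r, hG, hr, hdiv⟩ := exists_analyticOnNhd_eq_mul_add ω.denom_ne_zero hω
    ((analyticOnNhd_polynomial_eval ω.num _).mul hF)
  obtain ⟨f, -, hf⟩ := exists_mem_analyticClosedDisc hG
  refine (mem_toeplitz_domain_iff ω g).2 ⟨f, _, isStrictlyProper_div hr, polesOnCircle_div r hω, ?_⟩
  filter_upwards [hgF, hf, ae_boundaryValue_div r ω.denom_ne_zero,
    ae_eval_ne_zero ω.denom_ne_zero] with t h1 h2 h3 h4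
  have := hdiv (circlePoint t)
  rw [h1, h2, h3, boundaryValue_eq_div]
  field_simp
  linear_combination this

/-- If the quotient `n / d` of polynomials, with the roots of `d` on the circle, is square
integrable on the circle, then it is a polynomial. -/
theorem dvd_of_ae_eval_eq_mul {n d : Polynomial ℂ} (hd : d ≠ 0)
    (hroots : ∀ z : ℂ, d.IsRoot z → ‖z‖ = 1) (k : L2)
    (h : ∀ᵐ t ∂(haarAddCircle : Measure UnitAddCircle),
      n.eval (circlePoint t) = d.eval (circlePoint t) * k t) : d ∣ n := by
  obtain ⟨c, -, hc⟩ := exists_mem_analyticClosedDisc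
    (analyticOnNhd_polynomial_eval (n / d) (Metric.closedBall 0 1))
  -- (n mod d)/d is strictly proper and equals k minus the polynomial n/d, hence is square
  -- integrable, so it vanishes.
  have h0 := eq_zero_of_boundaryValue_ae_eq
    (isStrictlyProper_div (Polynomial.degree_mod_lt n hd)) (polesOnCircle_div _ hroots)
    (k - (c : L2)) (by
      filter_upwards [h, hc, ae_boundaryValue_div (n % d) hd, ae_eval_ne_zero hd,
        Lp.coeFn_sub k (c : L2)] with t h1 h2 h3 h4 h5
      have h6 := congrArg (Polynomial.eval (circlePoint t)) (EuclideanDomain.div_add_mod n d)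
      rw [Polynomial.eval_add, Polynomial.eval_mul, h1] at h6
      rw [h3, h5, Pi.sub_apply, h2, div_eq_iff h4]
      linear_combination h6)
  have hd' : algebraMap (Polynomial ℂ) (RatFunc ℂ) d ≠ 0 := by simpa using hd
  have h1 : n % d = 0 := by simpa [hd'] using h0
  exact (EuclideanDomain.mod_eq_zero).1 h1

/-- The domain of `T_ω` with `ω = s / q` is contained in the sum of `q H²` and the polynomials. -/
theorem exists_sub_mulPolyH2_mem_analyticClosedDisc {ω : RatFunc ℂ} (hω : PolesOnCircle ω) {g : H2}
    (hg : g ∈ (toeplitz ω).domain) :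
    ∃ k : H2, g - mulPolyH2 ω.denom k ∈ analyticClosedDisc := by
  obtain ⟨f, ρ, -, hpρ, he⟩ := (mem_toeplitz_domain_iff ω g).1 hg
  obtain ⟨u, v, huv⟩ := RatFunc.isCoprime_num_denom ω
  -- With us + vq = 1 and sg = q(f + ρ), one gets g = usg + vqg = q(uf + vg) + quρ.
  set k : L2 := mulPoly u f + mulPoly v g
  have hkt : ∀ᵐ t ∂(haarAddCircle : Measure UnitAddCircle),
      k t = u.eval (circlePoint t) * f t + v.eval (circlePoint t) * (g : L2) t := by
    filter_upwards [Lp.coeFn_add (mulPoly u f) (mulPoly v g), coeFn_mulPoly u f, coeFn_mulPoly v g]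
      with t h1 h2 h3
    rw [h1, Pi.add_apply, h2, h3]
  -- The identity g - qk = quρ, multiplied through by the denominator of ρ.
  have hkey : ∀ᵐ t ∂(haarAddCircle : Measure UnitAddCircle),
      (ω.denom * u * ρ.num).eval (circlePoint t) =
        ρ.denom.eval (circlePoint t) * ((g : L2) - mulPoly ω.denom k) t := by
    filter_upwards [he, hkt, coeFn_mulPoly ω.denom k, Lp.coeFn_sub (g : L2) (mulPoly ω.denom k),
      ae_eval_ne_zero ω.denom_ne_zero, ae_eval_ne_zero ρ.denom_ne_zero] with t h1 h2 h3 h4 h5 h6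
    have h7 := congrArg (Polynomial.eval (circlePoint t)) huv
    simp only [Polynomial.eval_add, Polynomial.eval_mul, Polynomial.eval_one] at h7
    rw [boundaryValue_eq_div, boundaryValue_eq_div] at h1
    field_simp at h1
    rw [h4, Pi.sub_apply, h3, h2, Polynomial.eval_mul, Polynomial.eval_mul]
    linear_combination (-u.eval (circlePoint t)) * h1 +
      (ρ.denom.eval (circlePoint t) * (g : L2) t) * h7
  obtain ⟨r, hr⟩ := dvd_of_ae_eval_eq_mul ρ.denom_ne_zero hpρ _ hkey
  obtain ⟨c, hc, hcr⟩ := exists_mem_analyticClosedDisc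
    (analyticOnNhd_polynomial_eval r (Metric.closedBall 0 1))
  have hgk : (g : L2) - mulPoly ω.denom k = c := by
    refine Lp.ext ?_
    filter_upwards [hkey, hcr, ae_eval_ne_zero ρ.denom_ne_zero] with t h1 h2 h3
    rw [hr, Polynomial.eval_mul] at h1
    rw [h2, ← mul_left_cancel₀ h3 h1]
  -- qk = g - c is a difference of elements of H², and the roots of q lie on the circle.
  have hkH : k ∈ H2 := by
    refine mem_H2_of_mulPoly_mem ω.denom_ne_zero hω ?_
    rw [← sub_sub_cancel (g : L2) (mulPoly ω.denom k), hgk]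
    exact H2.sub_mem g.2 c.2
  refine ⟨⟨k, hkH⟩, ?_⟩
  convert hc
  exact Subtype.ext hgk

/-- Since ω(qk) = sk already lies in H², one may take ρ = 0, and the projection fixes sk. -/
theorem mulPolyH2_prod_mem_toeplitzGraph (ω : RatFunc ℂ) (k : H2) :
    (mulPolyH2 ω.denom k, mulPolyH2 ω.num k) ∈ toeplitzGraph ω := by
  refine ⟨mulPolyH2 ω.num k, 0, by simp [IsStrictlyProper], by simp [PolesOnCircle], ?_,
    (Submodule.orthogonalProjectionOnto_mem_subspace_eq_self _).symm⟩
  filter_upwards [coeFn_mulPoly ω.denom k, coeFn_mulPoly ω.num k,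
    ae_eval_ne_zero ω.denom_ne_zero] with t h1 h2 h3
  rw [coe_mulPolyH2, coe_mulPolyH2, h1, h2, boundaryValue_eq_div]
  simp only [boundaryValue, RatFunc.eval_zero]
  field_simp
  simp

theorem mem_graph_domRestrict_of_mem {ω : RatFunc ℂ} {D : Submodule ℂ H2} {p : H2 × H2}
    (hp : p ∈ toeplitzGraph ω) (hD : p.1 ∈ D) : p ∈ ((toeplitz ω).domRestrict D).graph := by
  rw [← toeplitz_graph, LinearPMap.mem_graph_iff] at hp
  obtain ⟨y, hy1, hy2⟩ := hp
  rw [LinearPMap.mem_graph_iff]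
  refine ⟨⟨p.1, hD, hy1 ▸ y.2⟩, rfl, ?_⟩
  rw [← hy2]
  exact LinearPMap.domRestrict_apply hy1.symm

theorem isCore_analyticClosedDisc {ω : RatFunc ℂ} (hω : PolesOnCircle ω) :
    IsCore (toeplitz ω) analyticClosedDisc where
  le_domain _ hg := mem_toeplitz_domain_of_mem_analyticClosedDisc hω hg
  graph_subset_closure := by
    intro p hp
    set Γ := ((toeplitz ω).domRestrict analyticClosedDisc).graph
    rw [SetLike.mem_coe, toeplitz_graph] at hp
    have hdom : p.1 ∈ (toeplitz ω).domain := by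
      rw [LinearPMap.mem_domain_iff, toeplitz_graph]
      exact ⟨p.2, hp⟩
    obtain ⟨k, hk⟩ := exists_sub_mulPolyH2_mem_analyticClosedDisc hω hdom
    -- Split p = (p - A k) + A k: the first term lies in the restricted graph, and the second in its
    -- closure because A is continuous and maps the dense subspace `analyticClosedDisc` into that
    -- graph.
    set A : H2 →L[ℂ] H2 × H2 := (mulPolyH2 ω.denom).prod (mulPolyH2 ω.num)
    have hAk : A k ∈ Γ.topologicalClosure := by
      refine map_mem_closure A.continuous (mem_closure_analyticClosedDisc k) fun x hx => ?_
      exact mem_graph_domRestrict_of_mem (mulPolyH2_prod_mem_toeplitzGraph ω x)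
        (mulPolyH2_mem_analyticClosedDisc _ hx)
    have hsub : p - A k ∈ Γ.topologicalClosure := by
      refine Γ.le_topologicalClosure (mem_graph_domRestrict_of_mem ?_ hk)
      exact sub_mem hp (mulPolyH2_prod_mem_toeplitzGraph ω k)
    have := add_mem hsub hAk
    rwa [sub_add_cancel] at this

end ToeplitzLike

theorem theorem6p2 (ω : RatFunc ℂ) (hω : ToeplitzLike.PolesOnCircle ω) :
    ToeplitzLike.analyticClosedDisc ≤ (ToeplitzLike.toeplitz ω).domain ∧
    (ToeplitzLike.IsProper ω →
      ToeplitzLike.IsCore (ToeplitzLike.toeplitz ω) ToeplitzLike.analyticClosedDisc) :=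
  have h := ToeplitzLike.isCore_analyticClosedDisc hω
  ⟨h.le_domain, fun _ => h⟩
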